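/- Let $\kappa$ be an infinite cardinal, let $T$ be a first-order theory in a language $L$ with $|T|\le\kappa$ (that is, $|L|\le\kappa$), and let $\mathcal U$ be a monster model of $T$, i.e. a model of $T$ which is $\mu$-saturated and strongly $\mu$-homogeneous for some cardinal $\mu>\kappa$. Let $M\prec\mathcal U$ be an elementary submodel with $|M|\le\kappa$, and let $\phi(x;y)$ be an $L$-formula, with $x,y$ finite tuples of variables, which is NIP: there are no infinite set $A$ of $|x|$-tuples of $\mathcal U$ and $|y|$-tuples $b_I$ of $\mathcal U$ $(I\subseteq A)$ such that $\mathcal U\models\phi(a;b_I)\iff a\in I$ for all $a\in A$ and $I\subseteq A$. Let $S_\phi(\mathcal U)$ be the space of global $\phi$-types, i.e. of maximal consistent sets of formulas of the form $\phi(x;b)$, $\neg\phi(x;b)$ with $b\in\mathcal U^{|y|}$, with the topology generated by the sets $\{p: p\vdash\phi(x;b)\}$ and $\{p: p\vdash\neg\phi(x;b)\}$. Let $\mathrm{Inv}_\phi(M)\subseteq S_\phi(\mathcal U)$ be the set of $M$-invariant ones, i.e. those invariant under all automorphisms of $\mathcal U$ fixing $M$ pointwise. Let $\mathfrak P_{<\omega}(\kappa)$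 be the set of finite subsets of $\kappa$, and let $\mathfrak F_\kappa$ be the filter on it generated by the sets $\{i: i\supseteq j\}$, $j\in\mathfrak P_{<\omega}(\kappa)$. Let $Z\subseteq\mathrm{Inv}_\phi(M)$ be any subset, and let $p\in S_\phi(\mathcal U)$ be in the closure $\overline Z$ of $Z$. Then there is a family $(q_i: i\in\mathfrak P_{<\omega}(\kappa))$ of elements of $Z$ with $p=\lim_{\mathfrak F_\kappa}q_i$; that is, for every neighborhood $V$ of $p$, the set $\{i\in\mathfrak P_{<\omega}(\kappa): q_i\in V\}$ belongs to $\mathfrak F_\kappa$. -/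

import Mathlib

open Cardinal Filter Topology

universe u v w

namespace LocalTypes

open FirstOrder FirstOrder.Language

section Monster

variable (L : FirstOrder.Language.{u, v}) (U : Type w) [L.Structure U]

/-- `μ`-saturation: every finitely satisfiable set of formulas in finitely many variables, with
parameters from a set of size `< μ`, is realized. -/
def IsSaturated (μ : Cardinal.{w}) : Prop :=
  ∀ A : Set U, #A < μ → ∀ (k : ℕ) (S : Set (L[[A]].Formula (Fin k))),
    (∀ S₀ : Finset (L[[A]].Formula (Fin k)), (S₀ : Set (L[[A]].Formula (Fin k))) ⊆ S →
      ∃ a : Fin k → U, ∀ ψ ∈ S₀, ψ.Realize a) →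
    ∃ a : Fin k → U, ∀ ψ ∈ S, ψ.Realize a

/-- Strong `μ`-homogeneity: every partial elementary map whose domain `A` has size `< μ`
extends to an automorphism. The formulas below have their free variables indexed by `A`. -/
def IsStronglyHomogeneous (μ : Cardinal.{w}) : Prop :=
  ∀ A : Set U, #A < μ → ∀ f : A → U,
    (∀ ψ : L.Formula A, ψ.Realize (fun a : A => (a : U)) ↔ ψ.Realize f) →
    ∃ σ : U ≃[L] U, ∀ a : A, σ (a : U) = f a

end Monster

section PhiTypes

variable {L : FirstOrder.Language.{u, v}} (U : Type w) [L.Structure U] {n m : ℕ}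

/-- `φ(x; y)` is NIP: there are no infinite set `A` of `x`-tuples and `y`-tuples `b_I`, for
`I ⊆ A`, such that `φ(a; b_I) ↔ a ∈ I` for all `a ∈ A`. -/
def IsNIP (φ : L.Formula (Fin n ⊕ Fin m)) : Prop :=
  ¬ ∃ A : Set (Fin n → U), A.Infinite ∧
    ∀ I : Set (Fin n → U), I ⊆ A → ∃ b : Fin m → U,
      ∀ a ∈ A, φ.Realize (Sum.elim a b) ↔ a ∈ I

/-- The space `S_φ(U)` of complete `φ`-types over `U`. A type is given by the set `pos` of those
`b` for which it contains `φ(x; b)`; for the other `b` it contains `¬ φ(x; b)`. Consistency of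
this set of formulas with the elementary diagram of `U` means that each finite part of it is
realized in `U`. -/
@[ext]
structure PhiType (φ : L.Formula (Fin n ⊕ Fin m)) where
  pos : Set (Fin m → U)
  consistent : ∀ s : Finset (Fin m → U), ∃ a : Fin n → U,
    ∀ b ∈ s, φ.Realize (Sum.elim a b) ↔ b ∈ pos

variable {U}

/-- The topology on `S_φ(U)`: the sets of types containing a given formula `φ(x; b)`, or a given
formula `¬ φ(x; b)`, generate it. -/
instance (φ : L.Formula (Fin n ⊕ Fin m)) : TopologicalSpace (PhiType U φ) :=
  TopologicalSpace.generateFrom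
    (Set.range (fun b : Fin m → U => {p : PhiType U φ | b ∈ p.pos}) ∪
      Set.range (fun b : Fin m → U => {p : PhiType U φ | b ∉ p.pos}))

/-- The set `Inv_φ(M)` of `φ`-types over `U` that are invariant under the automorphisms of `U`
that fix `M` pointwise. -/
def Inv (φ : L.Formula (Fin n ⊕ Fin m)) (M : Set U) : Set (PhiType U φ) :=
  {p | ∀ σ : U ≃[L] U, (∀ c ∈ M, σ c = c) →
    ∀ b : Fin m → U, b ∈ p.pos ↔ (fun k => σ (b k)) ∈ p.pos}

end PhiTypes

/-- The set of finite subsets of `κ`. -/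
abbrev FinSubsets (κ : Cardinal.{w}) : Type w := Finset κ.ord.ToType

/-- The filter on the finite subsets of `κ` generated by the sets `{i | i ⊇ j}`. -/
def finFilter (κ : Cardinal.{w}) : Filter (FinSubsets κ) :=
  Filter.generate (Set.range (fun j : FinSubsets κ => {i : FinSubsets κ | j ⊆ i}))

end LocalTypes

/-! The proof has two independent halves, each using NIP in its own way.

Small subsets suffice (`exists_small_mem_closure`). For a finite sign pattern `ε`, `agreeSet q ε`
collects the tuples on which `q` takes the values `ε`. Suppose no `κ` members of `Z` cover `agreeSet
p ε`. A closing-off argument over the at most `κ` many `M`-definable sets gives a small set `G` of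
uncovered tuples meeting every definable set that the uncovered tuples still meet after any further
small enlargement. Since `p ∈ closure Z`, some ultralimit `r` of members of `Z` is right on `G`, yet
it is wrong on every tuple left uncovered by the types used to form it. So on one coordinate, the
invariant type `r` takes both values densely on a common closed set of types over `M`. By
`not_isNIP_of_dense` this contradicts NIP: realizing `r` on small sets of representatives repeatedly
builds an infinite shattered sequence.

From `κ` many types to a limit (`exists_tendsto_finFilter`). Let `𝒰` be an ultrafilter on the small
set converging to `p`. NIP yields a sign word `s` for which `IteratedMeets` fails
(`exists_not_iteratedMeets`). The failures are witnessed by `𝒰`-large sets `failSet`; only `κ` many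
of them have parameters from the small set, and a filter containing these and the small set already
converges to `p` (`setOf_mem_pos_iff_mem`). The type `q i` is chosen inside the finitely many large
sets indexed by `i`. -/

namespace LocalTypes

open FirstOrder FirstOrder.Language

/-! ### Saturation and counting for definable sets. -/

section Saturation

variable {L : FirstOrder.Language.{u, v}} {U : Type w} [L.Structure U]

theorem IsSaturated.exists_mem_of_finset {μ : Cardinal.{w}} (hsat : IsSaturated L U μ)
    {A : Set U} (hA : #A < μ) {k : ℕ} {𝒮 : Set (Set (Fin k → U))}
    (hdef : ∀ D ∈ 𝒮, A.Definable L D)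
    (hfin : ∀ 𝒯 : Finset (Set (Fin k → U)), (𝒯 : Set (Set (Fin k → U))) ⊆ 𝒮 →
      ∃ a, ∀ D ∈ 𝒯, a ∈ D) :
    ∃ a, ∀ D ∈ 𝒮, a ∈ D := by
  classical
  obtain ⟨a, ha⟩ := hsat A hA k {ψ | Set.ofPred ψ.Realize ∈ 𝒮} (by
    intro S₀ hS₀
    obtain ⟨a, ha⟩ := hfin (S₀.image fun ψ => Set.ofPred ψ.Realize) (by
      intro D hD
      obtain ⟨ψ, hψ, rfl⟩ := Finset.mem_image.1 (Finset.mem_coe.1 hD)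
      exact hS₀ hψ)
    exact ⟨a, fun ψ hψ => ha _ (Finset.mem_image_of_mem _ hψ)⟩)
  refine ⟨a, fun D hD => ?_⟩
  obtain ⟨ψ, rfl⟩ := hdef D hD
  exact ha ψ hD

theorem IsSaturated.exists_mem_of_directed {μ : Cardinal.{w}} (hsat : IsSaturated L U μ)
    {A : Set U} (hA : #A < μ) {k : ℕ} {𝒮 : Set (Set (Fin k → U))}
    (hdef : ∀ D ∈ 𝒮, A.Definable L D) (hne : 𝒮.Nonempty)
    (hdir : ∀ D ∈ 𝒮, ∀ E ∈ 𝒮, ∃ F ∈ 𝒮, F ⊆ D ∩ E) (hmem : ∀ D ∈ 𝒮, D.Nonempty) :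
    ∃ a, ∀ D ∈ 𝒮, a ∈ D := by
  classical
  refine hsat.exists_mem_of_finset hA hdef fun 𝒯 h𝒯 => ?_
  have key : ∃ F ∈ 𝒮, ∀ D ∈ 𝒯, F ⊆ D := by
    induction 𝒯 using Finset.induction_on with
    | empty => exact hne.imp fun F hF => ⟨hF, by simp⟩
    | insert D 𝒯 _ ih =>
      obtain ⟨F, hF, hFD⟩ := ih fun E hE => h𝒯 (by simp [Finset.mem_coe.1 hE])
      obtain ⟨G, hG, hGD⟩ := hdir D (h𝒯 (by simp)) F hF
      refine ⟨G, hG, fun E hE => ?_⟩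
      rcases Finset.mem_insert.1 hE with rfl | hE
      · exact hGD.trans Set.inter_subset_left
      · exact (hGD.trans Set.inter_subset_right).trans (hFD E hE)
  obtain ⟨F, hF, hFD⟩ := key
  obtain ⟨a, ha⟩ := hmem F hF
  exact ⟨a, fun D hD => hFD D hD ha⟩

theorem mk_definable_le {κ : Cardinal.{w}} (hκ : ℵ₀ ≤ κ)
    (hT : Cardinal.lift.{w} L.card ≤ Cardinal.lift.{max u v} κ) {A : Set U} (hA : #A ≤ κ)
    (α : Type) [Finite α] : #{D : Set (α → U) | A.Definable L D} ≤ κ := by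
  have hinj : Function.Injective
      (fun ψ : L.Formula (A ⊕ α) => (⟨0, ψ⟩ : Σ n, L.BoundedFormula (A ⊕ α) n)) :=
    fun ψ ψ' h => eq_of_heq (Sigma.mk.inj h).2
  have h1 := (Cardinal.mk_le_of_injective hinj).trans BoundedFormula.card_le
  have h2 : #(A ⊕ α) ≤ κ := by
    rw [mk_sum, lift_id']
    refine add_le_of_le hκ (by simpa using hA) ?_
    exact (lift_le_aleph0.2 (mk_le_aleph0 (α := α))).trans hκ
  have h3 : #(L.Formula (A ⊕ α)) ≤ Cardinal.lift.{max u v} κ := by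
    refine h1.trans (max_le (aleph0_le_lift.2 hκ) (add_le_of_le (aleph0_le_lift.2 hκ) ?_ ?_))
    · exact Cardinal.lift_le.2 h2
    · simpa using hT
  have h4 : {D : Set (α → U) | A.Definable L D} ⊆
      Set.range fun ψ : L.Formula (A ⊕ α) => {v | ψ.Realize (Sum.elim (↑) v)} := by
    intro D hD
    obtain ⟨ψ, rfl⟩ := Set.definable_iff_exists_formula_sum.1 hD
    exact ⟨ψ, rfl⟩
  refine (mk_le_mk_of_subset h4).trans ?_
  rw [← Cardinal.lift_le.{max u v}]
  refine le_trans (le_of_eq ?_) ((mk_range_le_lift (f := fun ψ : L.Formula (A ⊕ α) =>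
    {v : α → U | ψ.Realize (Sum.elim (↑) v)})).trans ?_)
  · exact lift_umax.{w, max u v}.symm ▸ rfl
  · exact (lift_id'.{w, max u v} _).trans_le h3

end Saturation

/-! ### Types over `M` and automorphisms. -/

section Homogeneity

variable {L : FirstOrder.Language.{u, v}} {U : Type w} [L.Structure U]

variable (L) in
/-- Two tuples have the same type over `M`. -/
def SameType (M : Set U) {m : ℕ} (b b' : Fin m → U) : Prop :=
  ∀ D : Set (Fin m → U), M.Definable L D → (b ∈ D ↔ b' ∈ D)

theorem sameType_of_imp {M : Set U} {m : ℕ} {b b' : Fin m → U}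
    (h : ∀ D : Set (Fin m → U), M.Definable L D → b ∈ D → b' ∈ D) : SameType L M b b' :=
  fun D hD => ⟨h D hD, fun hb' => by_contra fun hb => h Dᶜ hD.compl hb hb'⟩

theorem definable_setOf_realize {M : Set U} {A : Type*} {α : Type*} (ψ : L.Formula A)
    (g : A → M ⊕ α) :
    M.Definable L {c : α → U | ψ.Realize (Sum.elim (↑) c ∘ g)} :=
  Set.definable_iff_exists_formula_sum.2 ⟨ψ.relabel g, by ext c; simp [Formula.realize_relabel]⟩

theorem IsStronglyHomogeneous.exists_equiv {μ : Cardinal.{w}} (hhom : IsStronglyHomogeneous L U μ)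
    (hμ : ℵ₀ ≤ μ) {M : Set U} (hM : #M < μ) {m : ℕ} {b b' : Fin m → U} (h : SameType L M b b') :
    ∃ σ : U ≃[L] U, (∀ c ∈ M, σ c = c) ∧ ∀ k, σ (b k) = b' k := by
  classical
  have hidx : ∀ a : ↥(M ∪ Set.range b), (a : U) ∉ M → ∃ k, b k = a := fun a ha =>
    a.2.resolve_left ha
  let g : ↥(M ∪ Set.range b) → M ⊕ Fin m := fun a =>
    if ha : (a : U) ∈ M then Sum.inl ⟨a, ha⟩ else Sum.inr (hidx a ha).choose
  have hgb : ∀ a, Sum.elim ((↑) : M → U) b (g a) = a := by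
    intro a
    by_cases ha : (a : U) ∈ M
    · simp [g, ha]
    · simpa [g, ha] using (hidx a ha).choose_spec
  have hcard : #↥(M ∪ Set.range b) < μ := by
    refine (mk_union_le _ _).trans_lt (add_lt_of_lt hμ hM ?_)
    exact (Set.finite_range b).lt_aleph0.trans_le hμ
  obtain ⟨σ, hσ⟩ := hhom _ hcard (fun a => Sum.elim ((↑) : M → U) b' (g a)) (by
    intro ψ
    have := h _ (definable_setOf_realize ψ g)
    simp only [Set.mem_ofPred_eq] at this
    rwa [show Sum.elim ((↑) : M → U) b ∘ g = Subtype.val from funext hgb] at this)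
  refine ⟨σ, fun c hc => ?_, fun k => ?_⟩
  · rw [hσ ⟨c, Or.inl hc⟩]
    simp [g, hc]
  -- The entry `b k` may lie in `M` or repeat another entry, so `g` may name it differently. That
  -- coincidence is an `M`-definable condition on `b`, so it passes to `b'`.
  · have hk : M.Definable L {c : Fin m → U | c k = Sum.elim ((↑) : M → U) c
        (g ⟨b k, Or.inr ⟨k, rfl⟩⟩)} := by
      have := definable_setOf_realize (L := L) (M := M)
        (Term.equal (Term.var (0 : Fin 2)) (Term.var 1))
        (![Sum.inr k, g ⟨b k, Or.inr ⟨k, rfl⟩⟩] : Fin 2 → M ⊕ Fin m)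
      simpa [Formula.realize_equal] using this
    have := (h _ hk).1 (hgb ⟨b k, Or.inr ⟨k, rfl⟩⟩).symm
    rw [hσ ⟨b k, Or.inr ⟨k, rfl⟩⟩]
    exact this.symm

theorem Inv.mem_pos_iff {μ : Cardinal.{w}} (hhom : IsStronglyHomogeneous L U μ)
    (hμ : ℵ₀ ≤ μ) {M : Set U} (hM : #M < μ) {n m : ℕ} {φ : L.Formula (Fin n ⊕ Fin m)}
    {q : PhiType U φ} (hq : q ∈ Inv φ M) {b b' : Fin m → U} (h : SameType L M b b') :
    b ∈ q.pos ↔ b' ∈ q.pos := by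
  obtain ⟨σ, hσM, hσb⟩ := hhom.exists_equiv hμ hM h
  rw [hq σ hσM b, funext hσb]

end Homogeneity

/-! ### Shattered sequences and compactness. -/

section Patterns

variable {L : FirstOrder.Language.{u, v}} {U : Type w} [L.Structure U] {n m : ℕ}

/-- The tuples `b` for which `φ(a; b)` has truth value `e`. -/
def fiber (φ : L.Formula (Fin n ⊕ Fin m)) (a : Fin n → U) (e : Bool) : Set (Fin m → U) :=
  {b | φ.Realize (Sum.elim a b) ↔ e = true}

/-- The tuples `b` for which the truth values of `φ(a; b)`, for `a` in the list `l`, are given by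
`s`, which is indexed by the number of elements that follow `a`. -/
def pattern (φ : L.Formula (Fin n ⊕ Fin m)) : List (Fin n → U) → (ℕ → Bool) → Set (Fin m → U)
  | [], _ => Set.univ
  | a :: l, s => fiber φ a (s l.length) ∩ pattern φ l s

variable {φ : L.Formula (Fin n ⊕ Fin m)}

theorem definable_fiber {A : Set U} {a : Fin n → U} (ha : ∀ i, a i ∈ A) (e : Bool) :
    A.Definable L (fiber φ a e) := by
  have h : A.Definable L {b : Fin m → U | φ.Realize (Sum.elim a b)} := by
    convert definable_setOf_realize (M := A) φ
      (Sum.elim (fun i => Sum.inl ⟨a i, ha i⟩) Sum.inr : Fin n ⊕ Fin m → A ⊕ Fin m) using 4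
    ext (i | j) <;> rfl
  cases e
  · convert h.compl using 1
    ext b
    simp [fiber]
  · simpa [fiber] using h

theorem definable_pattern {A : Set U} {l : List (Fin n → U)} (hl : ∀ a ∈ l, ∀ i, a i ∈ A)
    (s : ℕ → Bool) : A.Definable L (pattern φ l s) := by
  induction l with
  | nil => exact Set.definable_univ
  | cons a l ih =>
    exact (definable_fiber (hl a (by simp)) _).inter (ih fun a ha => hl a (by simp [ha]))

theorem finite_range_pattern (φ : L.Formula (Fin n ⊕ Fin m)) (l : List (Fin n → U)) :
    (Set.range (pattern φ l)).Finite := by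
  induction l with
  | nil => exact (Set.finite_singleton Set.univ).subset (by rintro _ ⟨s, rfl⟩; rfl)
  | cons a l ih =>
    refine ((Set.finite_range (fiber φ a)).image2 (· ∩ ·) ih).subset ?_
    rintro _ ⟨s, rfl⟩
    exact ⟨_, ⟨s l.length, rfl⟩, _, ⟨s, rfl⟩, rfl⟩

theorem pattern_congr {l : List (Fin n → U)} {s t : ℕ → Bool}
    (h : ∀ i < l.length, s i = t i) : pattern φ l s = pattern φ l t := by
  induction l with
  | nil => rfl
  | cons a l ih =>
    simp only [pattern, h l.length (by simp), ih fun i hi => h i (hi.trans (by simp))]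

/-- The first `k` terms of a sequence, in reverse order. -/
def initial {α : Type*} (a : ℕ → α) : ℕ → List α
  | 0 => []
  | k + 1 => a k :: initial a k

@[simp] theorem length_initial {α : Type*} (a : ℕ → α) (k : ℕ) : (initial a k).length = k := by
  induction k with
  | zero => rfl
  | succ k ih => simp [initial, ih]

theorem mem_initial {α : Type*} {a : ℕ → α} {k : ℕ} {x : α} (hx : x ∈ initial a k) :
    ∃ i, a i = x := by
  induction k with
  | zero => simp [initial] at hx
  | succ k ih =>
    rcases List.mem_cons.1 hx with rfl | hx
    · exact ⟨k, rfl⟩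
    · exact ih hx

theorem mem_pattern_initial {a : ℕ → Fin n → U} {k : ℕ} {s : ℕ → Bool} {b : Fin m → U} :
    b ∈ pattern φ (initial a k) s ↔ ∀ i < k, b ∈ fiber φ (a i) (s i) := by
  induction k with
  | zero => simp [initial, pattern]
  | succ k ih =>
    simp only [initial, pattern, Set.mem_inter_iff, ih, length_initial]
    constructor
    · rintro ⟨h1, h2⟩ i hi
      rcases Nat.lt_succ_iff_lt_or_eq.1 hi with hi | rfl
      exacts [h2 i hi, h1]
    · exact fun h => ⟨h k (Nat.lt_succ_self k), fun i hi => h i (hi.trans (Nat.lt_succ_self k))⟩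

theorem exists_seq_of_step {α : Type*} {P : List α → Prop} [Nonempty α] (h0 : P [])
    (hstep : ∀ l, P l → ∃ a, P (a :: l)) : ∃ a : ℕ → α, ∀ k, P (initial a k) := by
  classical
  choose! f hf using hstep
  let l : ℕ → List α := fun k => Nat.rec [] (fun _ l => f l :: l) k
  refine ⟨fun k => f (l k), fun k => ?_⟩
  have hl : initial (fun k => f (l k)) k = l k := by
    induction k with
    | zero => rfl
    | succ k ih => rw [initial, ih]
  rw [hl]
  induction k with
  | zero => exact h0
  | succ k ih => exact hf _ (ih (by
      have := hl
      simp only [initial] at this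
      exact (List.cons.inj this).2))

/-- All patterns occur on the list `l`. -/
def IsShattered (φ : L.Formula (Fin n ⊕ Fin m)) (l : List (Fin n → U)) : Prop :=
  ∀ s, (pattern φ l s).Nonempty

/-- Every subset of the sequence is cut out on finite initial segments by assumption, and saturation
over the countably many entries gives one `b` for the whole sequence. -/
theorem not_isNIP_of_seq {μ : Cardinal.{w}} (hsat : IsSaturated L U μ) (hμ : ℵ₀ < μ)
    {a : ℕ → Fin n → U} (ha : ∀ k, IsShattered φ (initial a k)) : ¬ IsNIP U φ := by
  classical
  have hinj : Function.Injective a := by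
    intro i j hij
    by_contra hne
    -- A pattern that is true at `i` only separates `a i` from `a j`; the length `i + j + 1` covers
    -- both indices.
    obtain ⟨b, hb⟩ := ha (i + j + 1) (fun k => decide (k = i))
    have h1 := mem_pattern_initial.1 hb i (by omega)
    have h2 := mem_pattern_initial.1 hb j (by omega)
    rw [← hij] at h2
    simp only [fiber, Set.mem_ofPred_eq, decide_eq_true_eq] at h1 h2
    exact hne (h2.1 (h1.2 trivial)).symm
  refine fun h => h ⟨Set.range a, Set.infinite_range_of_injective hinj, fun I _ => ?_⟩
  have hA : #(Set.range fun p : ℕ × Fin n => a p.1 p.2) < μ :=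
    (Cardinal.mk_le_aleph0_iff.2 (Set.countable_range _).to_subtype).trans_lt hμ
  obtain ⟨b, hb⟩ := hsat.exists_mem_of_directed hA
    (𝒮 := Set.range fun k => pattern φ (initial a k) fun i => decide (a i ∈ I))
    (by
      rintro _ ⟨k, rfl⟩
      refine definable_pattern (fun x hx i => ?_) _
      obtain ⟨j, rfl⟩ := mem_initial hx
      exact ⟨(j, i), rfl⟩)
    (Set.range_nonempty _)
    (by
      rintro _ ⟨k, rfl⟩ _ ⟨k', rfl⟩
      refine ⟨_, ⟨max k k', rfl⟩, fun b hb => ?_⟩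
      rw [mem_pattern_initial] at hb
      exact ⟨mem_pattern_initial.2 fun i hi => hb i (lt_max_of_lt_left hi),
        mem_pattern_initial.2 fun i hi => hb i (lt_max_of_lt_right hi)⟩)
    (by rintro _ ⟨k, rfl⟩; exact ha k _)
  refine ⟨b, ?_⟩
  rintro _ ⟨i, rfl⟩
  have := mem_pattern_initial.1 (hb _ ⟨i + 1, rfl⟩) i (Nat.lt_succ_self i)
  simpa [fiber] using this

/-- The list `l` extends to shattered lists by arbitrarily many elements. -/
def IsExtendable (φ : L.Formula (Fin n ⊕ Fin m)) (l : List (Fin n → U)) (N : ℕ) : Prop :=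
  ∃ l' : List (Fin n → U), l'.length = N ∧ IsShattered φ (l' ++ l)

theorem pattern_append_subset (l' l : List (Fin n → U)) (s : ℕ → Bool) :
    pattern φ (l' ++ l) s ⊆ pattern φ l s := by
  induction l' with
  | nil => exact subset_rfl
  | cons a l' ih => exact Set.inter_subset_right.trans ih

theorem IsExtendable.of_succ {l : List (Fin n → U)} {N : ℕ} (h : IsExtendable φ l (N + 1)) :
    IsExtendable φ l N := by
  obtain ⟨_ | ⟨a, l'⟩, hl', hs⟩ := h
  · simp at hl'
  · exact ⟨l', by simpa using hl', fun s =>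
      (hs s).mono (pattern_append_subset [a] (l' ++ l) s)⟩

theorem IsExtendable.anti {l : List (Fin n → U)} {N N' : ℕ} (hN : N ≤ N')
    (h : IsExtendable φ l N') : IsExtendable φ l N := by
  induction hN with
  | refl => exact h
  | step _ ih => exact ih h.of_succ

theorem IsExtendable.of_cons {a : Fin n → U} {l : List (Fin n → U)} {N : ℕ}
    (h : IsExtendable φ (a :: l) N) : IsExtendable φ l (N + 1) := by
  obtain ⟨l', hl', hs⟩ := h
  exact ⟨l' ++ [a], by simp [hl'], by simpa using hs⟩

theorem IsExtendable.exists_cons {l : List (Fin n → U)} {N : ℕ} (h : IsExtendable φ l (N + 1)) :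
    ∃ a, IsExtendable φ (a :: l) N := by
  obtain ⟨l', hl', hs⟩ := h
  obtain ⟨l'', a, rfl⟩ := List.eq_nil_or_concat' l' |>.resolve_left (by rintro rfl; simp at hl')
  exact ⟨a, l'', by simpa using hl', by simpa using hs⟩

/-- The list of tuples whose entries are the elements of `A` and the values of the variables named
by `l`. -/
def evalList {A : Set U} {γ : Type} (l : List (Fin n → A ⊕ γ)) (v : γ → U) : List (Fin n → U) :=
  l.map fun g i => Sum.elim (↑) v (g i)

theorem evalList_map_inl {A : Set U} {γ δ : Type} (l : List (Fin n → A ⊕ γ)) (v : γ → U)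
    (w : δ → U) :
    evalList (l.map fun g i => Sum.map id Sum.inl (g i)) (Sum.elim v w) = evalList l v := by
  simp only [evalList, List.map_map]
  refine List.map_congr_left fun g _ => funext fun i => ?_
  simp only [Function.comp_apply]
  cases g i <;> rfl

theorem definable_setOf_mem_pattern {A : Set U} {γ : Type} (l : List (Fin n → A ⊕ γ))
    (y : Fin m → γ) (s : ℕ → Bool) :
    A.Definable L {v : γ → U | v ∘ y ∈ pattern φ (evalList l v) s} := by
  induction l with
  | nil => exact Set.definable_univ
  | cons g l ih =>
    have h := definable_setOf_realize (M := A) φ (Sum.elim g (Sum.inr ∘ y))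
    refine Set.Definable.inter (f := {v : γ → U |
      v ∘ y ∈ fiber φ (fun i => Sum.elim (↑) v (g i)) (s (evalList l v).length)}) ?_ ih
    have hv : ∀ v : γ → U, (Sum.elim ((↑) : A → U) v ∘ Sum.elim g (Sum.inr ∘ y)) =
        Sum.elim (fun i => Sum.elim (↑) v (g i)) (v ∘ y) := by
      intro v
      ext (i | j) <;> rfl
    simp only [hv] at h
    simp only [evalList, List.length_map]
    cases s l.length
    · convert h.compl using 1
      ext v
      simp [fiber]
    · simpa [fiber] using h

theorem definable_setOf_isShattered {A : Set U} {γ : Type} (l : List (Fin n → A ⊕ γ)) :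
    A.Definable L {v : γ → U | IsShattered φ (evalList l v)} := by
  have h : ∀ s : Fin l.length → Bool, A.Definable L {v : γ → U | ∃ b : Fin m → U,
      b ∈ pattern φ (evalList l v) fun i => if hi : i < l.length then s ⟨i, hi⟩ else false} := by
    intro s
    have := (definable_setOf_mem_pattern (φ := φ)
      (l.map fun g i => Sum.map id Sum.inl (g i)) (Sum.inr : Fin m → γ ⊕ Fin m)
      fun i => if hi : i < l.length then s ⟨i, hi⟩ else false).exists_of_finite
    simpa only [Set.mem_ofPred_eq, evalList_map_inl, Sum.elim_comp_inr] using this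
  convert Set.definable_iInter_of_finite h using 1
  ext v
  simp only [IsShattered, Set.mem_iInter, Set.mem_ofPred_eq]
  refine ⟨fun hv s => hv _, fun hv s => ?_⟩
  obtain ⟨b, hb⟩ := hv fun i => s i
  refine ⟨b, ?_⟩
  rwa [pattern_congr fun i hi => ?_]
  rw [dif_pos (by simpa [evalList] using hi)]

/-- Each step adds `n` fresh variables for a new tuple and projects them away. The lists name
variables symbolically so that the induction can enlarge the variable set. -/
theorem definable_setOf_isExtendable {A : Set U} {γ : Type} (l : List (Fin n → A ⊕ γ)) (N : ℕ) :
    A.Definable L {v : γ → U | IsExtendable φ (evalList l v) N} := by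
  induction N generalizing γ with
  | zero => simpa [IsExtendable] using definable_setOf_isShattered l
  | succ N ih =>
    have := (ih ((fun i => Sum.inr (Sum.inr i)) ::
      l.map fun g i => Sum.map id Sum.inl (g i) : List (Fin n → A ⊕ (γ ⊕ Fin n)))).exists_of_finite
    convert this using 1
    ext v
    have hv : ∀ a : Fin n → U, evalList ((fun i => Sum.inr (Sum.inr i)) ::
        l.map fun g i => Sum.map id Sum.inl (g i) : List (Fin n → A ⊕ (γ ⊕ Fin n))) (Sum.elim v a) =
        a :: evalList l v := by
      intro a
      rw [← evalList_map_inl l v a]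
      rfl
    simp only [Set.mem_ofPred_eq, hv]
    exact ⟨IsExtendable.exists_cons, fun ⟨a, h⟩ => h.of_cons⟩

theorem definable_isExtendable {A : Set U} {l : List (Fin n → U)}
    (hl : ∀ a ∈ l, ∀ i, a i ∈ A) (N : ℕ) :
    A.Definable L {a : Fin n → U | IsExtendable φ (a :: l) N} := by
  have h := definable_setOf_isExtendable (φ := φ) (A := A) (γ := Fin n)
    (Sum.inr :: l.pmap (fun a ha i => Sum.inl ⟨a i, ha i⟩) hl) N
  convert h using 3 with v
  simp [evalList, List.map_pmap]

/-- The invariant is extendability by every finite `N`. The sets of good next tuples decrease with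
`N` and are definable, so saturation finds one tuple good for all `N`. -/
theorem not_isNIP_of_forall_isExtendable {μ : Cardinal.{w}} (hsat : IsSaturated L U μ)
    (hμ : ℵ₀ < μ) (h : ∀ N, IsExtendable φ ([] : List (Fin n → U)) N) : ¬ IsNIP U φ := by
  have : Nonempty (Fin n → U) := (IsExtendable.exists_cons (h 1)).nonempty
  obtain ⟨a, ha⟩ := exists_seq_of_step (P := fun l => ∀ N, IsExtendable φ l N) h (by
    intro l hl
    have hA : #(⋃ a ∈ {a | a ∈ l}, Set.range a : Set U) < μ := by
      refine (Set.Finite.lt_aleph0 ?_).trans hμ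
      exact (List.finite_toSet l).biUnion fun a _ => Set.finite_range a
    obtain ⟨a, ha⟩ := hsat.exists_mem_of_directed hA
      (𝒮 := Set.range fun N => {a : Fin n → U | IsExtendable φ (a :: l) N})
      (by
        rintro _ ⟨N, rfl⟩
        exact definable_isExtendable
          (fun a ha i => Set.mem_biUnion (s := {a | a ∈ l}) (t := Set.range) ha ⟨i, rfl⟩) N)
      (Set.range_nonempty _)
      (by
        rintro _ ⟨N, rfl⟩ _ ⟨N', rfl⟩
        refine ⟨_, ⟨max N N', rfl⟩, fun a ha => ?_⟩
        exact ⟨IsExtendable.anti (le_max_left _ _) ha, IsExtendable.anti (le_max_right _ _) ha⟩)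
      (by rintro _ ⟨N, rfl⟩; exact (hl (N + 1)).exists_cons)
    exact ⟨a, fun N => ha _ ⟨N, rfl⟩⟩)
  refine not_isNIP_of_seq (a := a) hsat hμ fun k => ?_
  obtain ⟨l', hl', hs⟩ := ha k 0
  obtain rfl := List.length_eq_zero_iff.1 hl'
  exact hs

end Patterns

/-! ### Invariant types and reduction to small subsets. -/

section InvariantTypes

variable {L : FirstOrder.Language.{u, v}} {U : Type w} [L.Structure U] {n m : ℕ}
  {φ : L.Formula (Fin n ⊕ Fin m)} {κ μ : Cardinal.{w}}

theorem definable_setOf_realize_left {A : Set U} {b : Fin m → U} (hb : ∀ i, b i ∈ A) :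
    A.Definable L {a : Fin n → U | φ.Realize (Sum.elim a b)} := by
  convert definable_setOf_realize (M := A) φ
    (Sum.elim Sum.inr (fun i => Sum.inl ⟨b i, hb i⟩) : Fin n ⊕ Fin m → A ⊕ Fin n) using 4
  ext (i | j) <;> rfl

theorem PhiType.exists_realize (hsat : IsSaturated L U μ) (hκ : ℵ₀ ≤ κ) (hμ : κ < μ)
    (q : PhiType U φ) {C : Set (Fin m → U)} (hC : #C ≤ κ) :
    ∃ a : Fin n → U, ∀ b ∈ C, φ.Realize (Sum.elim a b) ↔ b ∈ q.pos := by
  classical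
  have hA : #(Set.range fun p : C × Fin m => p.1.1 p.2) < μ := by
    refine (mk_range_le.trans ?_).trans_lt hμ
    rw [mk_prod]
    refine mul_le_of_le hκ (by simpa using hC) ?_
    exact (lift_le_aleph0.2 (mk_le_aleph0 (α := Fin m))).trans hκ
  obtain ⟨a, ha⟩ := hsat.exists_mem_of_finset hA
    (𝒮 := (fun b => {a : Fin n → U | φ.Realize (Sum.elim a b) ↔ b ∈ q.pos}) '' C)
    (by
      rintro _ ⟨b, hb, rfl⟩
      have h := definable_setOf_realize_left (φ := φ) (b := b)
        (A := Set.range fun p : C × Fin m => p.1.1 p.2) fun i => ⟨(⟨b, hb⟩, i), rfl⟩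
      by_cases hbq : b ∈ q.pos
      · simpa [hbq] using h
      · simpa [hbq, Set.compl_ofPred] using h.compl)
    (by
      intro 𝒯 h𝒯
      obtain ⟨t, -, ht⟩ := Finset.subset_set_image_iff.1 h𝒯
      obtain ⟨a, ha⟩ := q.consistent t
      refine ⟨a, fun D hD => ?_⟩
      rw [← ht] at hD
      obtain ⟨b, hb, rfl⟩ := Finset.mem_image.1 hD
      exact ha b hb)
  exact ⟨a, fun b hb => ha _ ⟨b, hb, rfl⟩⟩

variable (L) in
/-- Every tuple in one of the sets `B e` has the same type over `M` as some element of `Y`. -/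
def IsRich (M : Set U) (B : Bool → Set (Fin m → U)) (Y : Set (Fin m → U)) : Prop :=
  ∀ e, ∀ b ∈ B e, ∃ b' ∈ Y, SameType L M b b'

/-- Richness and invariance put in each `Y` representatives of both `q`-values for all relevant
definable sets. A realization `a` of `q` on these at most `κ` tuples turns `q`-values into values of
`φ(a; ·)`. -/
theorem exists_isRich_fiber [Nonempty (Fin m → U)] (hsat : IsSaturated L U μ) (hhom : IsStronglyHomogeneous L U μ)
    (hκ : ℵ₀ ≤ κ) (hμ : κ < μ)
    (hT : Cardinal.lift.{w} L.card ≤ Cardinal.lift.{max u v} κ) {M : Set U} (hM : #M ≤ κ)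
    {q : PhiType U φ} (hq : q ∈ Inv φ M) {B : Bool → Set (Fin m → U)}
    (hBq : ∀ e, ∀ b ∈ B e, b ∈ q.pos ↔ e = true)
    (hB : ∀ D : Set (Fin m → U), M.Definable L D → ∀ e e',
      (D ∩ B e).Nonempty → (D ∩ B e').Nonempty)
    {A : Set U} (hMA : M ⊆ A) (hA : #A ≤ κ) {𝒴 : Set (Set (Fin m → U))} (h𝒴 : 𝒴.Finite)
    (hdef : ∀ Y ∈ 𝒴, A.Definable L Y) (hrich : ∀ Y ∈ 𝒴, IsRich L M B Y) :
    ∃ a : Fin n → U, ∀ Y ∈ 𝒴, ∀ e, IsRich L M B (fiber φ a e ∩ Y) := by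
  have hrep : ∀ p : {D : Set (Fin m → U) | M.Definable L D} × Bool × 𝒴, ∃ c : Fin m → U,
      (p.1.1 ∩ B p.2.1).Nonempty →
        c ∈ p.1.1 ∧ c ∈ p.2.2.1 ∧ (c ∈ q.pos ↔ p.2.1 = true) := by
    rintro ⟨⟨D, hD⟩, e, ⟨Y, hY⟩⟩
    by_cases hne : (D ∩ B e).Nonempty
    · obtain ⟨b, hbD, hb⟩ := hne
      obtain ⟨b', hb'Y, hbb'⟩ := hrich Y hY e b hb
      refine ⟨b', fun _ => ⟨(hbb' D hD).1 hbD, hb'Y, ?_⟩⟩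
      rw [← Inv.mem_pos_iff hhom (hκ.trans hμ.le) (hM.trans_lt hμ) hq hbb']
      exact hBq e b hb
    · exact ⟨Classical.arbitrary _, fun h => absurd h hne⟩
  choose c hc using hrep
  have hC : #(Set.range c) ≤ κ := by
    refine mk_range_le.trans ?_
    rw [mk_prod, mk_prod]
    simp only [lift_id, Cardinal.lift_uzero]
    refine mul_le_of_le hκ (mk_definable_le hκ hT hM _) (mul_le_of_le hκ ?_ ?_)
    · exact (lift_le_aleph0.2 (mk_le_aleph0 (α := Bool))).trans hκ
    · exact h𝒴.lt_aleph0.le.trans hκ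
  obtain ⟨a, ha⟩ := q.exists_realize hsat hκ hμ hC
  refine ⟨a, fun Y hY e e' b hb => ?_⟩
  have hAa : #↑(A ∪ Set.range a) < μ := by
    refine ((mk_union_le _ _).trans (add_le_of_le hκ hA ?_)).trans_lt hμ
    exact (Set.finite_range a).lt_aleph0.le.trans hκ
  have hY' : (A ∪ Set.range a).Definable L (fiber φ a e ∩ Y) :=
    (definable_fiber (fun i => Set.mem_union_right _ (Set.mem_range_self i)) e).inter
      ((hdef Y hY).mono Set.subset_union_left)
  obtain ⟨b', hb'⟩ := hsat.exists_mem_of_directed hAa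
    (𝒮 := (fun D => D ∩ (fiber φ a e ∩ Y)) '' {D | M.Definable L D ∧ b ∈ D})
    (by
      rintro _ ⟨D, ⟨hD, -⟩, rfl⟩
      exact (hD.mono (hMA.trans Set.subset_union_left)).inter hY')
    ⟨_, Set.univ, ⟨Set.definable_univ, trivial⟩, rfl⟩
    (by
      rintro _ ⟨D, ⟨hD, hbD⟩, rfl⟩ _ ⟨E, ⟨hE, hbE⟩, rfl⟩
      refine ⟨_, ⟨D ∩ E, ⟨hD.inter hE, hbD, hbE⟩, rfl⟩, ?_⟩
      rintro x ⟨⟨hxD, hxE⟩, hx⟩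
      exact ⟨⟨hxD, hx⟩, hxE, hx⟩)
    (by
      rintro _ ⟨D, ⟨hD, hbD⟩, rfl⟩
      -- The tuple `b` comes from side `e'` while the fiber asks for `e`; `hB` switches sides inside
      -- `D`.
      obtain ⟨h1, h2, h3⟩ := hc (⟨D, hD⟩, e, ⟨Y, hY⟩) (hB D hD e' e ⟨b, hbD, hb⟩)
      exact ⟨_, h1, (ha _ ⟨_, rfl⟩).trans h3, h2⟩)
  exact ⟨b', (hb' _ ⟨Set.univ, ⟨Set.definable_univ, trivial⟩, rfl⟩).2,
    sameType_of_imp fun D hD hbD => (hb' _ ⟨D, ⟨hD, hbD⟩, rfl⟩).1⟩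

/-- An invariant `φ`-type of a formula that is NIP does not take both values densely on a closed
set of types over `M`. -/
theorem not_isNIP_of_dense (hsat : IsSaturated L U μ) (hhom : IsStronglyHomogeneous L U μ)
    (hκ : ℵ₀ ≤ κ) (hμ : κ < μ)
    (hT : Cardinal.lift.{w} L.card ≤ Cardinal.lift.{max u v} κ) {M : Set U} (hM : #M ≤ κ)
    {q : PhiType U φ} (hq : q ∈ Inv φ M) {B : Bool → Set (Fin m → U)}
    (hBq : ∀ e, ∀ b ∈ B e, b ∈ q.pos ↔ e = true)
    (hB : ∀ D : Set (Fin m → U), M.Definable L D → ∀ e e',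
      (D ∩ B e).Nonempty → (D ∩ B e').Nonempty)
    (hne : (B true).Nonempty) : ¬ IsNIP U φ := by
  have : Nonempty (Fin n → U) := ⟨(q.consistent ∅).choose⟩
  obtain ⟨b, hb⟩ := hne
  have : Nonempty (Fin m → U) := ⟨b⟩
  obtain ⟨a, ha⟩ := exists_seq_of_step
    (P := fun l => ∀ s, IsRich L M B (pattern φ l s))
    (fun s e b hb => ⟨b, trivial, fun _ _ => Iff.rfl⟩) (by
      intro l hl
      have hA : #↑(M ∪ ⋃ a ∈ {a | a ∈ l}, Set.range a) ≤ κ := by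
        refine (mk_union_le _ _).trans (add_le_of_le hκ hM (le_trans (le_of_lt ?_) hκ))
        exact ((List.finite_toSet l).biUnion fun a _ => Set.finite_range a).lt_aleph0
      obtain ⟨a, ha⟩ := exists_isRich_fiber hsat hhom hκ hμ hT hM hq hBq hB
        Set.subset_union_left hA (finite_range_pattern φ l)
        (by
          rintro _ ⟨s, rfl⟩
          exact definable_pattern (fun a ha i => Set.mem_union_right _
            (Set.mem_biUnion (s := {a | a ∈ l}) (t := Set.range) ha ⟨i, rfl⟩)) s)
        (by rintro _ ⟨s, rfl⟩; exact hl s)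
      exact ⟨a, fun s => ha _ ⟨s, rfl⟩ _⟩)
  refine not_isNIP_of_seq (a := a) hsat (hκ.trans_lt hμ) fun k s => ?_
  obtain ⟨b', hb', -⟩ := ha k s true b hb
  exact ⟨b', hb'⟩

/-- The limit of a family of `φ`-types along an ultrafilter. -/
def PhiType.ultralimit {ι : Type*} (𝒱 : Ultrafilter ι) (q : ι → PhiType U φ) : PhiType U φ where
  pos := {b | ∀ᶠ i in 𝒱, b ∈ (q i).pos}
  consistent s := by
    have h : ∀ᶠ i in 𝒱, ∀ b ∈ s, b ∈ (q i).pos ↔ ∀ᶠ i in 𝒱, b ∈ (q i).pos := by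
      refine (Filter.eventually_all_finset s).2 fun b _ => ?_
      by_cases hb : ∀ᶠ i in 𝒱, b ∈ (q i).pos
      · exact hb.mono fun i hi => iff_of_true hi hb
      · exact (Ultrafilter.eventually_not.2 hb).mono fun i hi => iff_of_false hi hb
    obtain ⟨i, hi⟩ := h.exists
    obtain ⟨a, ha⟩ := (q i).consistent s
    exact ⟨a, fun b hb => (ha b hb).trans (hi b hb)⟩

theorem PhiType.mem_pos_ultralimit {ι : Type*} {𝒱 : Ultrafilter ι} {q : ι → PhiType U φ}
    {b : Fin m → U} : b ∈ (PhiType.ultralimit 𝒱 q).pos ↔ ∀ᶠ i in 𝒱, b ∈ (q i).pos := Iff.rfl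

theorem PhiType.eventually_mem_pos_iff {ι : Type*} {𝒱 : Ultrafilter ι} {q : ι → PhiType U φ}
    (b : Fin m → U) :
    ∀ᶠ i in 𝒱, b ∈ (q i).pos ↔ b ∈ (PhiType.ultralimit 𝒱 q).pos := by
  rw [PhiType.mem_pos_ultralimit]
  by_cases hb : ∀ᶠ i in 𝒱, b ∈ (q i).pos
  · exact hb.mono fun i hi => iff_of_true hi hb
  · exact (Ultrafilter.eventually_not.2 hb).mono fun i hi => iff_of_false hi hb

theorem PhiType.ultralimit_mem_inv {ι : Type*} {𝒱 : Ultrafilter ι} {q : ι → PhiType U φ}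
    {M : Set U} (hq : ∀ i, q i ∈ Inv φ M) : PhiType.ultralimit 𝒱 q ∈ Inv φ M := by
  intro σ hσ b
  simp only [PhiType.mem_pos_ultralimit]
  exact eventually_congr (Eventually.of_forall fun i => hq i σ hσ b)

theorem PhiType.nhds_eq (p : PhiType U φ) :
    𝓝 p = ⨅ b : Fin m → U, 𝓟 {q | b ∈ q.pos ↔ b ∈ p.pos} := by
  refine le_antisymm (le_iInf fun b => le_principal_iff.2 ?_) ?_
  · by_cases hb : b ∈ p.pos
    · simp only [hb, iff_true]
      exact (TopologicalSpace.isOpen_generateFrom_of_mem (Or.inl ⟨b, rfl⟩)).mem_nhds hb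
    · simp only [hb, iff_false]
      exact (TopologicalSpace.isOpen_generateFrom_of_mem (Or.inr ⟨b, rfl⟩)).mem_nhds hb
  · rw [TopologicalSpace.nhds_generateFrom]
    refine le_iInf₂ fun s hs => ?_
    rcases hs with ⟨hps, ⟨b, rfl⟩ | ⟨b, rfl⟩⟩
    · exact iInf_le_of_le b (principal_mono.2 fun q hq => hq.2 hps)
    · exact iInf_le_of_le b (principal_mono.2 fun q hq h => hps (hq.1 h))

theorem mem_closure_iff_forall_finite {Z : Set (PhiType U φ)} {p : PhiType U φ} :
    p ∈ closure Z ↔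
      ∀ t : Set (Fin m → U), t.Finite → ∃ q ∈ Z, ∀ b ∈ t, b ∈ q.pos ↔ b ∈ p.pos := by
  have h := Filter.hasBasis_iInf_principal_finite
    fun b : Fin m → U => {q : PhiType U φ | b ∈ q.pos ↔ b ∈ p.pos}
  rw [← PhiType.nhds_eq] at h
  simp [mem_closure_iff_nhds_basis h]

/-- If finitely many sets cover a nonempty set `X`, then one of them is dense in some nonempty
relatively open subset of `X`, for the topology generated by the definable sets. -/
theorem exists_definable_dense_part {A : Set U} {α ι : Type*} [Finite ι] {X : Set (α → U)}
    (hX : X.Nonempty) {P : ι → Set (α → U)} (hP : X ⊆ ⋃ j, P j) :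
    ∃ j, ∃ C, A.Definable L C ∧ (C ∩ X).Nonempty ∧
      ∀ D, A.Definable L D → (D ∩ (C ∩ X)).Nonempty → (D ∩ (C ∩ X ∩ P j)).Nonempty := by
  classical
  cases nonempty_fintype ι
  by_contra! hcon
  -- If no piece is dense anywhere, shrinking `C` avoids the pieces one after another.
  have key : ∀ t : Finset ι, ∃ C, A.Definable L C ∧ (C ∩ X).Nonempty ∧
      ∀ j ∈ t, C ∩ X ∩ P j = ∅ := by
    intro t
    induction t using Finset.induction_on with
    | empty => exact ⟨Set.univ, Set.definable_univ, by simpa using hX, by simp⟩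
    | insert j t _ ih =>
      obtain ⟨C, hC, hCX, ht⟩ := ih
      obtain ⟨D, hD, hDX, hDj⟩ := hcon j C hC hCX
      refine ⟨D ∩ C, hD.inter hC, by rwa [Set.inter_assoc], fun i hi => ?_⟩
      rcases Finset.mem_insert.1 hi with rfl | hi
      · simpa only [Set.inter_assoc] using hDj
      · refine Set.subset_eq_empty ?_ (ht i hi)
        exact Set.inter_subset_inter_left _ (Set.inter_subset_inter_left _ Set.inter_subset_right)
  obtain ⟨C, -, ⟨v, hv⟩, hj⟩ := key Finset.univ
  obtain ⟨j, hvj⟩ := Set.mem_iUnion.1 (hP hv.2)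
  exact (hj j (Finset.mem_univ j)).le ⟨hv, hvj⟩

theorem mk_iUnion_le_of_le {α ι : Type w} (hκ : ℵ₀ ≤ κ) (hι : #ι ≤ κ) {s : ι → Set α}
    (hs : ∀ i, #(s i) ≤ κ) : #(⋃ i, s i) ≤ κ :=
  (mk_iUnion_le s).trans (mul_le_of_le hκ hι (ciSup_le' hs))

/-- The tuples of `y`-tuples on which `q` takes the values `ε`. -/
def agreeSet (q : PhiType U φ) {N : ℕ} (ε : Fin N → Bool) : Set (Fin N × Fin m → U) :=
  {v | ∀ j, (fun k => v (j, k)) ∈ q.pos ↔ ε j = true}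

theorem iff_eq_true_of_ne {P : Prop} {e e' : Bool} (he : e ≠ e') (h : ¬ (P ↔ e' = true)) :
    P ↔ e = true := by
  cases e <;> cases e' <;> simp_all

theorem exists_small_agreeSet_subset (hsat : IsSaturated L U μ)
    (hhom : IsStronglyHomogeneous L U μ) (hκ : ℵ₀ ≤ κ) (hμ : κ < μ)
    (hT : Cardinal.lift.{w} L.card ≤ Cardinal.lift.{max u v} κ) {M : Set U} (hM : #M ≤ κ)
    (hφ : IsNIP U φ) {Z : Set (PhiType U φ)} (hZ : Z ⊆ Inv φ M) {p : PhiType U φ}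
    (hp : p ∈ closure Z) {N : ℕ} (ε : Fin N → Bool) :
    ∃ Z₀ ⊆ Z, #Z₀ ≤ κ ∧ agreeSet p ε ⊆ ⋃ q ∈ Z₀, agreeSet q ε := by
  classical
  by_contra! hcon
  let X : Set (PhiType U φ) → Set (Fin N × Fin m → U) := fun Z₀ =>
    agreeSet p ε \ ⋃ q ∈ Z₀, agreeSet q ε
  have hXne : ∀ Z₀ ⊆ Z, #Z₀ ≤ κ → (X Z₀).Nonempty := fun Z₀ h1 h2 =>
    Set.sdiff_nonempty.2 (hcon Z₀ h1 h2)
  have hXanti : ∀ {Z₀ Z₁}, Z₀ ⊆ Z₁ → X Z₁ ⊆ X Z₀ := fun h =>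
    Set.sdiff_subset_sdiff_right (Set.biUnion_subset_biUnion_left h)
  let 𝒟 : Set (Set (Fin N × Fin m → U)) := {D | M.Definable L D}
  have h𝒟 : #𝒟 ≤ κ := mk_definable_le hκ hT hM _
  -- If some small subset makes `X` miss `D`, one such subset is used; otherwise any will do. The
  -- union over all `D` decides every definable set at once.
  have hstab : ∀ D : 𝒟, ∃ Z₀ ⊆ Z, #Z₀ ≤ κ ∧
      ∀ Z₁ ⊆ Z, #Z₁ ≤ κ → Z₀ ⊆ Z₁ → (D.1 ∩ X Z₀).Nonempty → (D.1 ∩ X Z₁).Nonempty := by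
    intro D
    by_cases h : ∃ Z₀ ⊆ Z, #Z₀ ≤ κ ∧ ¬ (D.1 ∩ X Z₀).Nonempty
    · obtain ⟨Z₀, h1, h2, h3⟩ := h
      exact ⟨Z₀, h1, h2, fun _ _ _ _ h4 => absurd h4 h3⟩
    · push Not at h
      exact ⟨∅, Set.empty_subset _, by simp, fun Z₁ h1 h2 _ _ => h Z₁ h1 h2⟩
  choose Z₀ hZ₀Z hZ₀κ hZ₀ using hstab
  let Z₁ := ⋃ D, Z₀ D
  have hZ₁Z : Z₁ ⊆ Z := Set.iUnion_subset hZ₀Z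
  have hZ₁κ : #Z₁ ≤ κ := mk_iUnion_le_of_le hκ h𝒟 hZ₀κ
  have : Nonempty (Fin N × Fin m → U) := (hXne _ hZ₁Z hZ₁κ).nonempty
  have hrep : ∀ D : 𝒟, ∃ c, (D.1 ∩ X Z₁).Nonempty → c ∈ D.1 ∩ X Z₁ := fun D => by
    by_cases h : (D.1 ∩ X Z₁).Nonempty
    · exact ⟨h.some, fun _ => h.some_mem⟩
    · exact ⟨Classical.arbitrary _, fun h' => absurd h' h⟩
  choose c hc using hrep
  let G : Set (Fin N × Fin m → U) := Set.range c ∩ X Z₁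
  have hGκ : #G ≤ κ := (mk_le_mk_of_subset Set.inter_subset_left).trans (mk_range_le.trans h𝒟)
  have happrox : ∀ s : Finset G, ∃ q ∈ Z, ∀ v ∈ s, v.1 ∈ agreeSet q ε := by
    intro s
    obtain ⟨q, hqZ, hq⟩ := mem_closure_iff_forall_finite.1 hp
      (⋃ v ∈ s, Set.range fun j => fun k => v.1 (j, k))
      (s.finite_toSet.biUnion fun v _ => Set.finite_range _)
    refine ⟨q, hqZ, fun v hv j => ?_⟩
    rw [hq _ (Set.mem_biUnion (x := v) hv ⟨j, rfl⟩)]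
    exact v.2.2.1 j
  choose q hqZ hq using happrox
  let Z₂ := Z₁ ∪ Set.range q
  have hZ₂Z : Z₂ ⊆ Z := Set.union_subset hZ₁Z (by rintro _ ⟨s, rfl⟩; exact hqZ s)
  have hZ₂κ : #Z₂ ≤ κ := by
    refine (mk_union_le _ _).trans (add_le_of_le hκ hZ₁κ (mk_range_le.trans ?_))
    refine (Cardinal.mk_le_of_surjective List.toFinset_surjective).trans ?_
    exact (mk_list_le_max _).trans (max_le hκ hGκ)
  -- An ultrafilter below `atTop` makes each element of `G` belong to almost every index `s`.
  let 𝒱 : Ultrafilter (Finset G) := Ultrafilter.of atTop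
  let r := PhiType.ultralimit 𝒱 q
  have hr : r ∈ Inv φ M := PhiType.ultralimit_mem_inv fun s => hZ (hqZ s)
  have hrG : ∀ v ∈ G, v ∈ agreeSet r ε := by
    intro v hv j
    have h1 : ∀ᶠ s : Finset G in 𝒱, ⟨v, hv⟩ ∈ s := Ultrafilter.of_le atTop
      ((eventually_ge_atTop {⟨v, hv⟩}).mono fun s hs => hs (by simp))
    obtain ⟨s, hs1, hs2⟩ := (h1.and (PhiType.eventually_mem_pos_iff (𝒱 := 𝒱) (q := q)
      fun k => v (j, k))).exists
    exact hs2.symm.trans (hq s _ hs1 j)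
  have hrX : ∀ v ∈ X Z₂, v ∉ agreeSet r ε := by
    intro v hv hvr
    -- With only `N` rows, some single `q s` agrees with `r` on all of `v`; but `q s ∈ Z₂`.
    obtain ⟨s, hs⟩ := (eventually_all.2 fun j : Fin N =>
      PhiType.eventually_mem_pos_iff (𝒱 := 𝒱) (q := q) fun k => v (j, k)).exists
    refine hv.2 (Set.mem_biUnion (x := q s) (Or.inr ⟨s, rfl⟩) fun j => ?_)
    exact (hs j).trans (hvr j)
  obtain ⟨j, C, hC, hCX, hCD⟩ := exists_definable_dense_part (L := L) (A := M)
    (hXne Z₂ hZ₂Z hZ₂κ)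
    (P := fun j => {v | ¬ ((fun k => v (j, k)) ∈ r.pos ↔ ε j = true)})
    (fun v hv => by simpa [agreeSet] using hrX v hv)
  let row : (Fin N × Fin m → U) → Fin m → U := fun v => v ∘ fun k => (j, k)
  let H : Set (Fin N × Fin m → U) := X Z₂ ∩ {v | ¬ (row v ∈ r.pos ↔ ε j = true)}
  have hGH : ∀ D, M.Definable L D → (D ∩ C ∩ G).Nonempty → (D ∩ C ∩ H).Nonempty := by
    rintro D hD ⟨v, hvDC, hvG⟩
    have hne : (D ∩ C ∩ X Z₂).Nonempty :=
      (hZ₀ ⟨D ∩ C, hD.inter hC⟩ Z₂ hZ₂Z hZ₂κ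
        ((Set.subset_iUnion Z₀ _).trans Set.subset_union_left)
        ⟨v, hvDC, hXanti (Set.subset_iUnion Z₀ _) hvG.2⟩)
    have := hCD D hD (by rwa [← Set.inter_assoc])
    rwa [Set.inter_assoc C, ← Set.inter_assoc D] at this
  have hHG : ∀ D, M.Definable L D → (D ∩ C ∩ H).Nonempty → (D ∩ C ∩ G).Nonempty := by
    rintro D hD ⟨v, hvDC, hvH⟩
    have h := hc ⟨D ∩ C, hD.inter hC⟩ ⟨v, hvDC, hXanti Set.subset_union_left hvH.1⟩
    exact ⟨_, h.1, ⟨_, rfl⟩, h.2⟩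
  have hrow : ∀ D : Set (Fin m → U), ∀ S, (D ∩ row '' (C ∩ S)).Nonempty ↔
      (row ⁻¹' D ∩ C ∩ S).Nonempty := by
    intro D S
    rw [Set.inter_comm, Set.image_inter_nonempty_iff, Set.inter_comm, Set.inter_assoc]
  have hG' : ∀ D : Set (Fin m → U), M.Definable L D →
      ((D ∩ row '' (C ∩ G)).Nonempty ↔ (D ∩ row '' (C ∩ H)).Nonempty) := fun D hD => by
    rw [hrow, hrow]
    exact ⟨hGH _ (hD.preimage_comp _), hHG _ (hD.preimage_comp _)⟩
  have hHne : (row '' (C ∩ H)).Nonempty := by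
    obtain ⟨v, -, hv, hv'⟩ := hCD Set.univ Set.definable_univ (by simpa using hCX)
    exact ⟨_, v, ⟨hv.1, hv.2, hv'⟩, rfl⟩
  have hGne : (row '' (C ∩ G)).Nonempty := by
    simpa using (hG' Set.univ Set.definable_univ).2 (by simpa using hHne)
  refine not_isNIP_of_dense hsat hhom hκ hμ hT hM hr
    (B := fun e => if e = ε j then row '' (C ∩ G) else row '' (C ∩ H)) ?_ ?_ ?_ hφ
  · intro e b hb
    split_ifs at hb with he
    · obtain ⟨v, hv, rfl⟩ := hb
      rw [he]
      exact hrG v hv.2 j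
    · obtain ⟨v, hv, rfl⟩ := hb
      exact iff_eq_true_of_ne he hv.2.2
  · intro D hD e e' h
    split_ifs at h ⊢
    exacts [h, (hG' D hD).2 h, (hG' D hD).1 h, h]
  · split_ifs
    exacts [hGne, hHne]

/-- The closure of a set of invariant `φ`-types is the union of the closures of its subsets of
size at most `κ`. -/
theorem exists_small_mem_closure (hsat : IsSaturated L U μ)
    (hhom : IsStronglyHomogeneous L U μ) (hκ : ℵ₀ ≤ κ) (hμ : κ < μ)
    (hT : Cardinal.lift.{w} L.card ≤ Cardinal.lift.{max u v} κ) {M : Set U} (hM : #M ≤ κ)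
    (hφ : IsNIP U φ) {Z : Set (PhiType U φ)} (hZ : Z ⊆ Inv φ M) {p : PhiType U φ}
    (hp : p ∈ closure Z) : ∃ Z₀ ⊆ Z, #Z₀ ≤ κ ∧ p ∈ closure Z₀ := by
  classical
  choose Z₀ hZ₀Z hZ₀κ hZ₀ using fun (N : ℕ) (ε : Fin N → Bool) =>
    exists_small_agreeSet_subset hsat hhom hκ hμ hT hM hφ hZ hp ε
  refine ⟨⋃ x : ULift.{w} (Σ N, Fin N → Bool), Z₀ x.down.1 x.down.2,
    Set.iUnion_subset fun x => hZ₀Z _ _, ?_, ?_⟩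
  · exact mk_iUnion_le_of_le hκ (mk_le_aleph0.trans hκ) fun x => hZ₀κ _ _
  · refine mem_closure_iff_forall_finite.2 fun t ht => ?_
    obtain ⟨N, b, hb⟩ := ht.fin_embedding
    have hmem : (fun x : Fin N × Fin m => b x.1 x.2) ∈
        agreeSet p fun j => decide (b j ∈ p.pos) := fun j => by simp
    obtain ⟨q, hq, hbq⟩ := Set.mem_iUnion₂.1 (hZ₀ N _ hmem)
    refine ⟨q, Set.mem_iUnion.2 ⟨⟨⟨N, _⟩⟩, hq⟩, ?_⟩
    rw [← hb]
    rintro _ ⟨j, rfl⟩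
    simpa using hbq j

end InvariantTypes

/-! ### Convergence along a filter with `κ` generators. -/

section Convergence

variable {L : FirstOrder.Language.{u, v}} {U : Type w} [L.Structure U] {n m : ℕ}
  {φ : L.Formula (Fin n ⊕ Fin m)} {κ μ : Cardinal.{w}}

/-- The tuples to which the `φ`-type `q` gives the truth value `e`. -/
def PhiType.side (q : PhiType U φ) (e : Bool) : Set (Fin m → U) :=
  {b | b ∈ q.pos ↔ e = true}

/-- For `𝒰`-almost all `q₁`, for `𝒰`-almost all `q₂`, and so on, some element of `Y` lies on
the sides of `q₁`, `q₂`, ... that the list prescribes. -/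
def IteratedMeets (𝒰 : Ultrafilter (PhiType U φ)) : Set (Fin m → U) → List Bool → Prop
  | Y, [] => Y.Nonempty
  | Y, e :: s => ∀ᶠ q : PhiType U φ in 𝒰, IteratedMeets 𝒰 (Y ∩ q.side e) s

/-- The types must not depend on the signs. Carrying a finite family `𝒴` lets one `q₀` serve all
sets and signs before the induction continues with both sides. -/
theorem exists_forall_nonempty {𝒰 : Ultrafilter (PhiType U φ)} (N : ℕ)
    {𝒴 : Set (Set (Fin m → U))} (h𝒴 : 𝒴.Finite)
    (h : ∀ Y ∈ 𝒴, ∀ s : List Bool, s.length = N → IteratedMeets 𝒰 Y s) :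
    ∃ q : ℕ → PhiType U φ, ∀ Y ∈ 𝒴, ∀ s : ℕ → Bool,
      (Y ∩ ⋂ i < N, (q i).side (s i)).Nonempty := by
  induction N generalizing 𝒴 with
  | zero =>
    obtain ⟨q, -⟩ := 𝒰.nonempty_of_mem univ_mem
    exact ⟨fun _ => q, fun Y hY s => by
      simpa [IteratedMeets] using h Y hY [] rfl⟩
  | succ N ih =>
    have h1 : ∀ᶠ q : PhiType U φ in 𝒰, ∀ Y ∈ 𝒴, ∀ e, ∀ s ∈ {s : List Bool | s.length = N},
        IteratedMeets 𝒰 (Y ∩ q.side e) s := by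
      refine (eventually_all_finite h𝒴).2 fun Y hY => eventually_all.2 fun e => ?_
      refine (eventually_all_finite (List.finite_length_eq Bool N)).2 fun s hs => ?_
      exact h Y hY (e :: s) (by simpa using hs)
    obtain ⟨q₀, hq₀⟩ := h1.exists
    obtain ⟨q, hq⟩ := ih (h𝒴.image2 (fun Y e => Y ∩ q₀.side e) Set.finite_univ) (by
      rintro _ ⟨Y, hY, e, -, rfl⟩ s hs
      exact hq₀ Y hY e s hs)
    refine ⟨fun i => Nat.casesOn i q₀ q, fun Y hY s => ?_⟩
    obtain ⟨b, ⟨hbY, hb0⟩, hb⟩ := hq _ ⟨Y, hY, s 0, trivial, rfl⟩ fun i => s (i + 1)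
    refine ⟨b, hbY, Set.mem_iInter₂.2 fun i hi => ?_⟩
    cases i with
    | zero => exact hb0
    | succ i => exact Set.mem_iInter₂.1 hb i (by omega)

/-- Otherwise, for every `N`, some `N` types show all sign patterns on finitely many `b`; realizing
the types on these gives shattered lists of every length. -/
theorem exists_not_iteratedMeets (hsat : IsSaturated L U μ) (hμ : ℵ₀ < μ) (hφ : IsNIP U φ)
    (𝒰 : Ultrafilter (PhiType U φ)) : ∃ s, ¬ IteratedMeets 𝒰 Set.univ s := by
  classical
  by_contra! hcon
  refine not_isNIP_of_forall_isExtendable hsat hμ (fun N => ?_) hφ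
  obtain ⟨q, hq⟩ := exists_forall_nonempty (𝒰 := 𝒰) N (Set.finite_singleton Set.univ)
    fun Y hY s _ => by rw [hY]; exact hcon s
  have hb : ∀ s : Fin N → Bool, ∃ b : Fin m → U,
      ∀ i : Fin N, b ∈ (q i).side (s i) := by
    intro s
    obtain ⟨b, -, hb⟩ := hq _ rfl fun i => if hi : i < N then s ⟨i, hi⟩ else false
    refine ⟨b, fun i => ?_⟩
    simpa using Set.mem_iInter₂.1 hb i i.2
  choose b hb using hb
  choose a ha using fun i : ℕ => (q i).consistent (Finset.univ.image b)
  refine ⟨initial a N, length_initial a N, fun s => ⟨b fun i => s i, ?_⟩⟩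
  rw [List.append_nil, mem_pattern_initial]
  intro i hi
  exact (ha i _ (Finset.mem_image_of_mem _ (Finset.mem_univ _))).trans (hb (fun i => s i) ⟨i, hi⟩)

/-- The finite intersections of sides of elements of `Z`. -/
def sideInter : List (PhiType U φ × Bool) → Set (Fin m → U)
  | [] => Set.univ
  | x :: l => sideInter l ∩ x.1.side x.2

/-- The `φ`-types `q` whose side `e` makes `IteratedMeets` fail, if almost all `q` are so, and all
`φ`-types otherwise. -/
def failSet (𝒰 : Ultrafilter (PhiType U φ)) (Y : Set (Fin m → U)) (e : Bool) (s : List Bool) :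
    Set (PhiType U φ) :=
  {q | ¬ IteratedMeets 𝒰 Y (e :: s) → ¬ IteratedMeets 𝒰 (Y ∩ q.side e) s}

theorem failSet_mem (𝒰 : Ultrafilter (PhiType U φ)) (Y : Set (Fin m → U)) (e : Bool)
    (s : List Bool) : failSet 𝒰 Y e s ∈ 𝒰 := by
  by_cases h : IteratedMeets 𝒰 Y (e :: s)
  · exact univ_mem' fun q hq => absurd h hq
  · exact mem_of_superset (Ultrafilter.eventually_not.2 h) fun q hq _ => hq

/-- If `IteratedMeets` fails for `Y`, then a filter that contains the sets `failSet` converges to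
the limit of `𝒰` at each element of `Y`. -/
theorem setOf_mem_pos_iff_mem {𝒰 : Ultrafilter (PhiType U φ)} {p : PhiType U φ}
    (hp : (𝒰 : Filter (PhiType U φ)) ≤ 𝓝 p) {Z : Set (PhiType U φ)} (hZ : Z ∈ 𝒰)
    {𝓕 : Filter (PhiType U φ)} (hZ𝓕 : Z ∈ 𝓕)
    (h𝓕 : ∀ l : List (PhiType U φ × Bool), (∀ x ∈ l, x.1 ∈ Z) → ∀ e s,
      failSet 𝒰 (sideInter l) e s ∈ 𝓕)
    (b : Fin m → U) (s : List Bool) (l : List (PhiType U φ × Bool)) (hl : ∀ x ∈ l, x.1 ∈ Z)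
    (hb : b ∈ sideInter l) (hs : ¬ IteratedMeets 𝒰 (sideInter l) s) :
    {q : PhiType U φ | b ∈ q.pos ↔ b ∈ p.pos} ∈ 𝓕 := by
  classical
  have hbp : {q : PhiType U φ | b ∈ q.pos ↔ b ∈ p.pos} ∈ 𝒰 := by
    rw [PhiType.nhds_eq] at hp
    exact hp (mem_iInf_of_mem b (mem_principal_self _))
  induction s generalizing l with
  | nil => exact absurd ⟨b, hb⟩ hs
  | cons e s ih =>
    by_contra hcon
    -- If `e` is the value of `p` at `b`, then `𝒰 → p` provides `q`. If not, lack of such a `q`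
    -- means that every type in `Z ∩ failSet` agrees with `p` at `b`, contrary to `hcon`. Adding
    -- `(q, e)` to `l` then shortens the word while keeping `b` in the intersection.
    have hq : ∃ q ∈ Z, b ∈ q.side e ∧ q ∈ failSet 𝒰 (sideInter l) e s := by
      by_cases he : b ∈ p.side e
      · obtain ⟨q, ⟨hq1, hq2⟩, hq3⟩ := 𝒰.nonempty_of_mem
          (inter_mem (inter_mem hZ hbp) (failSet_mem 𝒰 (sideInter l) e s))
        exact ⟨q, hq1, Iff.trans hq2 he, hq3⟩
      · by_contra! hno
        refine hcon (mem_of_superset (inter_mem hZ𝓕 (h𝓕 l hl e s)) fun q hq => ?_)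
        have := mt (hno q hq.1) (not_not.2 hq.2)
        simp only [PhiType.side, Set.mem_ofPred_eq] at he this ⊢
        tauto
    obtain ⟨q, hqZ, hqb, hq⟩ := hq
    exact hcon (ih ((q, e) :: l) (by simpa [hqZ] using hl) ⟨hb, hqb⟩ (hq hs))

/-- A `φ`-type in the closure of a set of size at most `κ` is the limit of a filter on that set
that has at most `κ` generators. -/
theorem exists_tendsto_finFilter (hsat : IsSaturated L U μ) (hκ : ℵ₀ ≤ κ) (hμ : κ < μ)
    (hφ : IsNIP U φ) {Z : Set (PhiType U φ)} (hZ : #Z ≤ κ) {p : PhiType U φ}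
    (hp : p ∈ closure Z) :
    ∃ q : FinSubsets κ → PhiType U φ, (∀ i, q i ∈ Z) ∧ Tendsto q (finFilter κ) (𝓝 p) := by
  obtain ⟨𝒰, hZ𝒰, h𝒰p⟩ := mem_closure_iff_ultrafilter.1 hp
  -- Indices for the `failSet`s with parameters in `Z`; the bound on `Z` is what keeps them to `κ`
  -- many.
  let I := List (Z × Bool) × Bool × List Bool
  have hI : #I ≤ #κ.ord.ToType := by
    rw [mk_ord_toType]
    rw [mk_prod, Cardinal.lift_uzero]
    refine mul_le_of_le hκ ((mk_list_le_max _).trans (max_le hκ ?_)) ?_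
    · rw [mk_prod, Cardinal.lift_uzero]
      exact mul_le_of_le hκ hZ ((lift_le_aleph0.2 mk_le_aleph0).trans hκ)
    · exact (lift_le_aleph0.2 mk_le_aleph0).trans hκ
  obtain ⟨f⟩ := hI
  let g := Function.invFun f
  have hg : Function.Surjective g := Function.invFun_surjective f.injective
  let W : I → Set (PhiType U φ) := fun x =>
    failSet 𝒰 (sideInter (x.1.map fun y => (y.1.1, y.2))) x.2.1 x.2.2
  have hq : ∀ i : FinSubsets κ, ∃ q ∈ Z, ∀ j ∈ i, q ∈ W (g j) := fun i => by
    obtain ⟨q, hq1, hq2⟩ := 𝒰.nonempty_of_mem (inter_mem hZ𝒰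
      ((biInter_finset_mem i).2 fun j _ => failSet_mem 𝒰 _ _ _ : ⋂ j ∈ i, W (g j) ∈ 𝒰))
    exact ⟨q, hq1, by simpa using hq2⟩
  choose q hqZ hqW using hq
  refine ⟨q, hqZ, ?_⟩
  obtain ⟨s, hs⟩ := exists_not_iteratedMeets hsat (hκ.trans_lt hμ) hφ 𝒰
  rw [PhiType.nhds_eq]
  refine tendsto_iInf.2 fun b => tendsto_principal.2 ?_
  refine setOf_mem_pos_iff_mem (𝓕 := Filter.map q (finFilter κ)) h𝒰p hZ𝒰
    (mem_map.2 (univ_mem' hqZ)) (fun l hl e s => ?_) b s [] (by simp) trivial hs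
  let l' : List (Z × Bool) := l.pmap
    (fun (x : PhiType U φ × Bool) (hx : x.1 ∈ Z) => ((⟨x.1, hx⟩ : Z), x.2)) hl
  obtain ⟨j, hj⟩ := hg (l', e, s)
  have hjW : W (g j) = failSet 𝒰 (sideInter l) e s := by
    simp [W, hj, l', List.map_pmap]
  refine mem_map.2 (mem_of_superset (mem_generate_of_mem ⟨{j}, rfl⟩) fun i hi => ?_)
  rw [Set.mem_preimage, ← hjW]
  exact hqW i j (Finset.singleton_subset_iff.1 hi)

end Convergence

end LocalTypes

theorem mainTheorem2 {L : FirstOrder.Language.{u, v}} (T : L.Theory)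
    -- the monster model `U` of `T`, relative to an infinite cardinal `κ`
    (U : Type w) [L.Structure U] [Nonempty U] (hU : T.Model U)
    (κ μ : Cardinal.{w}) (hκ : ℵ₀ ≤ κ) (hμ : κ < μ)
    (hsat : LocalTypes.IsSaturated L U μ) (hhom : LocalTypes.IsStronglyHomogeneous L U μ)
    -- `|T| ≤ κ`, where `|T|` is the size of the language up to `ℵ₀`, and `M ≺ U` with `|M| ≤ κ`
    (hT : Cardinal.lift.{w} L.card ≤ Cardinal.lift.{max u v} κ)
    (M : L.ElementarySubstructure U) (hM : #M ≤ κ)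
    {n m : ℕ} (φ : L.Formula (Fin n ⊕ Fin m)) (hφ : LocalTypes.IsNIP U φ)
    (Z : Set (LocalTypes.PhiType U φ)) (hZ : Z ⊆ LocalTypes.Inv φ (M : Set U))
    (p : LocalTypes.PhiType U φ) (hp : p ∈ closure Z) :
    ∃ q : LocalTypes.FinSubsets κ → LocalTypes.PhiType U φ,
      (∀ i, q i ∈ Z) ∧ Tendsto q (LocalTypes.finFilter κ) (𝓝 p) := by
  obtain ⟨Z₀, hZ₀Z, hZ₀κ, hpZ₀⟩ :=
    LocalTypes.exists_small_mem_closure hsat hhom hκ hμ hT hM hφ hZ hp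
  obtain ⟨q, hq, hqp⟩ := LocalTypes.exists_tendsto_finFilter hsat hκ hμ hφ hZ₀κ hpZ₀
  exact ⟨q, fun i => hZ₀Z (hq i), hqp⟩
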